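/- Let $\alpha>0$, $\mathbb{R}^+=(0,\infty)$ and $\mathbb{C}^+=\{z\in\mathbb{C}:\Re z>0\}$. For $f\in L_2(\mathbb{R}^+)$ (complex-valued) let $$\mathcal{D}^{-\alpha}f(x)=\int_0^x\frac{(x-y)^{\alpha-1}}{\Gamma(\alpha)}f(y)\,dy\qquad\text{for a.e. }x>0,$$ and let $\mathcal{R}_2^{(\alpha)}=\mathcal{D}^{-\alpha}(L_2(\mathbb{R}^+))$, functions on $\mathbb{R}^+$ being identified when they agree almost everywhere. Let $\mathcal{L}f(z)=\int_0^\infty e^{-zt}f(t)\,dt$ be the Laplace transform, let $z^{r}=e^{r\log z}$ for $r\in\mathbb{R}$ with the principal branch of $\log$, and let $H_2(\mathbb{C}^+)$ be the space of holomorphic functions $F$ on $\mathbb{C}^+$ with $$\sup_{x>0}\Big(\frac1{2\pi}\int_{-\infty}^{\infty}|F(x+iy)|^2\,dy\Big)^{1/2}<\infty.$$ Then for every $\varphi\in\mathcal{R}_2^{(\alpha)}$ there is a unique element $\mathcal{D}^{\alpha}\varphi$ of $L_2(\mathbb{R}^+)$ with $\varphi=\mathcal{D}^{-\alpha}(\mathcal{D}^{\alpha}\varphi)$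 a.e. on $\mathbb{R}^+$, and for every $z\in\mathbb{C}^+$ the integrals defining $\mathcal{L}(\varphi)(z)$ and $\mathcal{L}(\mathcal{D}^{\alpha}\varphi)(z)$ converge absolutely and $$\mathcal{L}(\mathcal{D}^{\alpha}\varphi)(z)=z^{\alpha}\,\mathcal{L}(\varphi)(z).$$ Consequently, as sets of functions on $\mathbb{C}^+$, $$\mathcal{L}(\mathcal{R}_2^{(\alpha)})=z^{-\alpha}H_2(\mathbb{C}^+):=\{z\mapsto z^{-\alpha}F(z)\;:\;F\in H_2(\mathbb{C}^+)\}.$$ -/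

import Mathlib

open MeasureTheory Set

noncomputable section

/-- The open right half-plane `ℂ⁺ = {z : Re z > 0}`. -/
def rightHalfPlane : Set ℂ := {z | 0 < z.re}

/-- Lebesgue measure on `ℝ⁺ = (0, ∞)`. -/
abbrev volPos : Measure ℝ := volume.restrict (Ioi (0 : ℝ))

/-- The Hilbert space `L²(ℝ⁺)` of (a.e. classes of) complex functions. -/
abbrev L2Pos : Type := Lp ℂ 2 volPos

/-- The Riemann-Liouville integral of order `α`:
`(𝒟^{-α} f)(x) = ∫₀ˣ (x - y)^{α-1} / Γ(α) · f(y) dy`, for `x > 0`. -/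
def rlIntegral (α : ℝ) (f : ℝ → ℂ) (x : ℝ) : ℂ :=
  ∫ y in Ioo 0 x, (((x - y) ^ (α - 1) / Real.Gamma α : ℝ) : ℂ) * f y

/-- The space `ℛ₂^{(α)} = 𝒟^{-α}(L²(ℝ⁺))`. Its elements are functions on `ℝ⁺` up to equality almost
everywhere; values on `(-∞, 0]` are irrelevant. -/
def rlSpace (α : ℝ) : Set (ℝ → ℂ) :=
  {φ | ∃ g : L2Pos, φ =ᵐ[volPos] rlIntegral α g}

open Classical in
/-- The Riemann-Liouville derivative `𝒟^α φ` of `φ ∈ ℛ₂^{(α)}`: the element `g` of `L²(ℝ⁺)` with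
`φ = 𝒟^{-α} g` a.e. on `ℝ⁺` (and `0` for `φ` outside `ℛ₂^{(α)}`). -/
def rlDeriv (α : ℝ) (φ : ℝ → ℂ) : L2Pos :=
  if h : ∃ g : L2Pos, φ =ᵐ[volPos] rlIntegral α g then h.choose else 0

/-- The integral that defines the Laplace transform of `f` at `z` converges absolutely. -/
def LaplaceConverges (f : ℝ → ℂ) (z : ℂ) : Prop :=
  IntegrableOn (fun t : ℝ => Complex.exp (-z * t) * f t) (Ioi 0)

/-- The Laplace transform `(ℒ f)(z) = ∫₀^∞ e^{-zt} f(t) dt`. -/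
def laplace (f : ℝ → ℂ) (z : ℂ) : ℂ :=
  ∫ t in Ioi (0 : ℝ), Complex.exp (-z * t) * f t

/-- The norm `sup_{x > 0} ((1 / 2π) ∫ |F(x + iy)|² dy)^{1/2}`, with values in `[0, ∞]`. -/
def hardyNorm (F : ℂ → ℂ) : ENNReal :=
  ⨆ (x : ℝ) (_ : 0 < x),
    (ENNReal.ofReal (1 / (2 * Real.pi)) * ∫⁻ y : ℝ, ‖F (x + y * Complex.I)‖ₑ ^ 2) ^ (1 / 2 : ℝ)

/-- The Hardy space `H₂(ℂ⁺)`: functions holomorphic on `ℂ⁺` with finite norm. Values outside `ℂ⁺`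
are irrelevant. -/
def hardyH2 : Set (ℂ → ℂ) :=
  {F | DifferentiableOn ℂ F rightHalfPlane ∧ hardyNorm F < ⊤}

end

open scoped FourierTransform Topology ENNReal

/-! `𝒟^{-α}` is convolution with a kernel whose Laplace transform is `z^{-α}`, so the convolution
theorem gives `ℒ(𝒟^{-α} g) = z^{-α} ℒ g` (`laplace_rlIntegral`). As `z^{-α}` has no zeros and `ℒ` is
injective on `L²(ℝ⁺)`, `𝒟^{-α}` is injective too. The range statement then amounts to `ℒ(L²(ℝ⁺)) =
H₂(ℂ⁺)`.

The inclusion `⊆` is Plancherel on each vertical line. For `⊇` (`exists_laplace_eq_of_mem_hardyH2`),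
let `γ_x` be the inverse Fourier transform of `F` on `Re z = x`. The point is that `G(t) = e^{xt}
γ_x(t)` does not depend on `x`. Since `F` need not be integrable on lines, it is paired with
`e^{za}/z`, which by Parseval yields the integral of `e^{xt} γ_x` over `(-∞, a]`; Cauchy's theorem
then moves the line. Finally `e^{-xt} G` is bounded in `L²` by the Hardy norm: `x → ∞` kills `G` on
`t < 0`, and `x → 0` puts `G` in `L²`. -/

/-! ### Plancherel's theorem for the Fourier integral -/

/-- The integral Fourier transform of an integrable function is continuous. -/
theorem continuous_fourier_of_integrable {f : ℝ → ℂ} (hf : Integrable f) : Continuous (𝓕 f) :=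
  VectorFourier.fourierIntegral_continuous Real.continuous_fourierChar
    (by exact continuous_inner) hf

open scoped ContDiff in
/-- On `L¹ ∩ L²` the Fourier transform of `L²` is given by the Fourier integral. -/
theorem coeFn_fourier_toLp {f : ℝ → ℂ} (hf : Integrable f) (hf2 : MemLp f 2) :
    (𝓕 (hf2.toLp f) : Lp ℂ 2 (volume : Measure ℝ)) =ᵐ[volume] 𝓕 f := by
  -- Test functions are Schwartz, so the `L²` transform can be computed by duality, as that of a
  -- tempered distribution.
  refine ae_eq_of_integral_contDiff_smul_eq
    ((Lp.memLp _).locallyIntegrable (by norm_num))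
    (continuous_fourier_of_integrable hf).locallyIntegrable ?_
  intro g g_smooth g_cpt
  have hg₁ : HasCompactSupport (Complex.ofRealCLM ∘ g) := g_cpt.comp_left rfl
  have hg₂ : ContDiff ℝ ∞ (Complex.ofRealCLM ∘ g) := by fun_prop
  set ψ := hg₁.toSchwartzMap hg₂ with hψ
  have e1 : ∫ x, g x • (𝓕 (hf2.toLp f) : Lp ℂ 2 (volume : Measure ℝ)) x
      = Lp.toTemperedDistribution (𝓕 (hf2.toLp f)) ψ := by
    simp [hψ]
  have e2 : ∫ x, (𝓕 ψ) x • (hf2.toLp f) x = ∫ x, (𝓕 (ψ : ℝ → ℂ)) x • f x := by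
    apply integral_congr_ae
    filter_upwards [hf2.coeFn_toLp] with x hx
    rw [hx, SchwartzMap.fourier_coe]
  have e3 : ∫ x, (𝓕 (ψ : ℝ → ℂ)) x • f x = ∫ x, ψ x • 𝓕 f x := by
    simpa using!
      VectorFourier.integral_fourierIntegral_smul_eq_flip (μ := volume) (ν := volume)
        (L := innerₗ ℝ) Real.continuous_fourierChar continuous_inner ψ.integrable hf
  rw [e1, ← Lp.fourier_toTemperedDistribution_eq, TemperedDistribution.fourier_apply,
    Lp.toTemperedDistribution_apply, e2, e3]
  simp [hψ]

/-- Plancherel's theorem on `L¹ ∩ L²`. -/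
theorem eLpNorm_fourier {f : ℝ → ℂ} (hf : Integrable f) (hf2 : MemLp f 2) :
    eLpNorm (𝓕 f) 2 = eLpNorm f 2 := by
  rw [← eLpNorm_congr_ae (coeFn_fourier_toLp hf hf2), ← eLpNorm_congr_ae hf2.coeFn_toLp,
    ← Lp.enorm_def, ← Lp.enorm_def, ← ofReal_norm, ← ofReal_norm,
    Lp.norm_fourier_eq]

theorem lintegral_enorm_sq_eq (f : ℝ → ℂ) (μ : Measure ℝ) :
    ∫⁻ x, ‖f x‖ₑ ^ 2 ∂μ = eLpNorm f 2 μ ^ 2 := by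
  have := eLpNorm_nnreal_pow_eq_lintegral (f := f) (μ := μ) (p := 2) (by norm_num)
  simpa using this.symm

/-! ### Laplace transforms of `L²(ℝ⁺)` functions -/

/-- The function `t ↦ e^{-xt} g(t)`, extended by `0` to the negative half-line. -/
noncomputable def expWeight (x : ℝ) (g : ℝ → ℂ) : ℝ → ℂ :=
  indicator (Ioi 0) fun t => Complex.exp (-x * t) * g t

theorem norm_exp_neg_mul (z : ℂ) (t : ℝ) : ‖Complex.exp (-z * t)‖ = Real.exp (-z.re * t) := by
  rw [Complex.norm_exp]; simp

/-- On the vertical line `Re z = x` the Laplace transform is a Fourier transform. -/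
theorem fourier_expWeight (x ξ : ℝ) (g : ℝ → ℂ) :
    𝓕 (expWeight x g) ξ = laplace g (x + (2 * Real.pi * ξ : ℝ) * Complex.I) := by
  rw [Real.fourier_real_eq_integral_exp_smul, laplace, ← integral_indicator measurableSet_Ioi]
  congr 1 with t
  by_cases ht : t ∈ Ioi (0 : ℝ)
  · simp only [expWeight, indicator_of_mem ht, smul_eq_mul, ← mul_assoc, ← Complex.exp_add]
    congr 2
    push_cast
    ring
  · simp [expWeight, indicator_of_notMem ht]

theorem memLp_exp_neg {z : ℂ} (hz : 0 < z.re) :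
    MemLp (fun t : ℝ => Complex.exp (-z * t)) 2 volPos := by
  rw [memLp_two_iff_integrable_sq_norm (by fun_prop)]
  have := integrableOn_exp_mul_Ioi (a := -(2 * z.re)) (by linarith) 0
  refine this.congr_fun (fun t _ => ?_) measurableSet_Ioi
  simp only [norm_exp_neg_mul, ← Real.exp_nat_mul]
  congr 1
  push_cast
  ring

theorem laplaceConverges_of_memLp {g : ℝ → ℂ} (hg : MemLp g 2 volPos) {z : ℂ}
    (hz : z ∈ rightHalfPlane) : LaplaceConverges g z :=
  (memLp_exp_neg hz).integrable_mul hg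

theorem integrable_expWeight {g : ℝ → ℂ} (hg : MemLp g 2 volPos) {x : ℝ} (hx : 0 < x) :
    Integrable (expWeight x g) := by
  have := laplaceConverges_of_memLp hg (z := x) (by simpa [rightHalfPlane] using hx)
  exact (integrable_indicator_iff measurableSet_Ioi).2 this

theorem eLpNorm_expWeight_le (g : ℝ → ℂ) {x : ℝ} (hx : 0 ≤ x) :
    eLpNorm (expWeight x g) 2 ≤ eLpNorm g 2 volPos := by
  rw [expWeight, eLpNorm_indicator_eq_eLpNorm_restrict measurableSet_Ioi]
  refine eLpNorm_mono_ae ?_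
  filter_upwards [ae_restrict_mem measurableSet_Ioi] with t ht
  have ht : 0 < t := ht
  rw [norm_mul, norm_exp_neg_mul]
  refine mul_le_of_le_one_left (norm_nonneg _) (Real.exp_le_one_iff.2 ?_)
  simp; positivity

theorem memLp_expWeight {g : ℝ → ℂ} (hg : MemLp g 2 volPos) {x : ℝ} (hx : 0 ≤ x) :
    MemLp (expWeight x g) 2 := by
  refine ⟨?_, (eLpNorm_expWeight_le g hx).trans_lt hg.2⟩
  refine (aestronglyMeasurable_indicator_iff measurableSet_Ioi).2 (.mul ?_ hg.1)
  fun_prop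

/-- A Laplace transform is holomorphic in the half-plane where its integral converges. -/
theorem differentiableOn_laplace {f : ℝ → ℂ} (hf : ∀ z ∈ rightHalfPlane, LaplaceConverges f z) :
    DifferentiableOn ℂ (laplace f) rightHalfPlane := by
  intro z hz
  obtain ⟨δ, hδ0, hδ⟩ : ∃ δ : ℝ, 0 < δ ∧ δ < z.re := exists_between hz
  -- Half of the decay `e^{-δt}` absorbs the factor `t` coming from the derivative; the other half
  -- leaves the integrand at `δ / 2`, integrable by hypothesis.
  have hδ' : ((δ / 2 : ℝ) : ℂ) ∈ rightHalfPlane := by simpa [rightHalfPlane] using hδ0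
  refine (hasDerivAt_integral_of_dominated_loc_of_deriv_le (s := {w : ℂ | δ < w.re})
    (F := fun w (t : ℝ) => Complex.exp (-w * t) * f t)
    (F' := fun w (t : ℝ) => -(t : ℂ) * Complex.exp (-w * t) * f t)
    (bound := fun t : ℝ => 2 / δ * ‖Complex.exp (-(δ / 2 : ℝ) * t) * f t‖)
    ((isOpen_lt continuous_const Complex.continuous_re).mem_nhds hδ) ?_ (hf z hz) ?_ ?_ ?_
    ?_).2.differentiableAt.differentiableWithinAt
  · filter_upwards [(isOpen_lt continuous_const Complex.continuous_re).mem_nhds hz] with w hw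
    exact (hf w hw).1
  · simp_rw [mul_assoc]
    exact AEStronglyMeasurable.mul (by fun_prop) (hf z hz).1
  · filter_upwards [ae_restrict_mem measurableSet_Ioi] with t ht w hw
    have ht : 0 < t := ht
    have hw : δ < w.re := hw
    rw [norm_mul, norm_mul, norm_mul, norm_exp_neg_mul, norm_exp_neg_mul, ← mul_assoc]
    refine mul_le_mul_of_nonneg_right ?_ (norm_nonneg _)
    have h1 : t ≤ 2 / δ * Real.exp (δ / 2 * t) := by
      have := (Real.add_one_le_exp (δ / 2 * t))
      calc t = 2 / δ * (δ / 2 * t) := by field_simp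
        _ ≤ _ := by gcongr; linarith
    calc ‖-(t : ℂ)‖ * Real.exp (-w.re * t) = t * Real.exp (-w.re * t) := by
          simp [abs_of_pos ht]
      _ ≤ 2 / δ * Real.exp (δ / 2 * t) * Real.exp (-δ * t) := by gcongr
      _ = _ := by
          rw [mul_assoc, ← Real.exp_add]
          congr 2
          simp
          ring
  · exact (hf _ hδ').norm.const_mul _
  · refine .of_forall fun t w _ => ?_
    have h1 : HasDerivAt (fun w : ℂ => -w * t) (-t) w := by
      simpa using ((hasDerivAt_id w).neg.mul_const (t : ℂ))
    convert! h1.cexp.mul_const (f t) using 1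
    ring

/-- The Laplace transform is injective on `L²(ℝ⁺)`. -/
theorem ae_eq_of_laplace_eq {g h : ℝ → ℂ} (hg : MemLp g 2 volPos) (hh : MemLp h 2 volPos)
    (H : ∀ z ∈ rightHalfPlane, laplace g z = laplace h z) : g =ᵐ[volPos] h := by
  have hgh : MemLp (g - h) 2 volPos := hg.sub hh
  -- The single line `Re z = 1` already determines the function, by Plancherel.
  have h0 : 𝓕 (expWeight 1 (g - h)) = 0 := by
    ext ξ
    rw [fourier_expWeight]
    set z : ℂ := (1 : ℝ) + (2 * Real.pi * ξ : ℝ) * Complex.I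
    have hz : z ∈ rightHalfPlane := by simp [z, rightHalfPlane]
    have := H z hz
    rw [Pi.zero_apply, ← sub_eq_zero.2 this, laplace, laplace, laplace,
      ← integral_sub (laplaceConverges_of_memLp hg hz) (laplaceConverges_of_memLp hh hz)]
    simp [mul_sub]
  have h1 := eLpNorm_fourier (integrable_expWeight hgh one_pos) (memLp_expWeight hgh zero_le_one)
  rw [h0, eLpNorm_zero, eq_comm, eLpNorm_eq_zero_iff (memLp_expWeight hgh zero_le_one).1
    (by norm_num)] at h1
  have h2 := ae_restrict_of_ae (s := Ioi 0) h1
  filter_upwards [h2, ae_restrict_mem measurableSet_Ioi] with t ht ht0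
  simpa [expWeight, indicator_of_mem ht0, sub_eq_zero] using ht

/-- The substitution `y = 2πξ` accounts for the factor `1 / 2π` in the Hardy norm. -/
theorem lintegral_comp_two_pi_mul (f : ℝ → ℝ≥0∞) :
    ∫⁻ ξ : ℝ, f (2 * Real.pi * ξ) = ENNReal.ofReal (1 / (2 * Real.pi)) * ∫⁻ y, f y := by
  have h := Real.map_volume_mul_left (a := 2 * Real.pi) (by positivity)
  have hm : MeasurableEmbedding fun ξ : ℝ => 2 * Real.pi * ξ :=
    (Homeomorph.mulLeft₀ (2 * Real.pi) (by positivity)).measurableEmbedding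
  rw [← hm.lintegral_map, h, lintegral_smul_measure, abs_of_pos (by positivity), one_div,
    smul_eq_mul]

/-- The Hardy norm as a supremum of `L²` norms on vertical lines. -/
theorem hardyNorm_eq_iSup (F : ℂ → ℂ) : hardyNorm F = ⨆ (x : ℝ) (_ : 0 < x),
    eLpNorm (fun ξ : ℝ => F (x + (2 * Real.pi * ξ : ℝ) * Complex.I)) 2 := by
  refine iSup_congr fun x => iSup_congr fun _ => ?_
  rw [← lintegral_comp_two_pi_mul fun y => ‖F (x + y * Complex.I)‖ₑ ^ 2,
    lintegral_enorm_sq_eq fun ξ : ℝ => F (x + (2 * Real.pi * ξ : ℝ) * Complex.I),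
    ← ENNReal.rpow_natCast, ← ENNReal.rpow_mul]
  norm_num

/-- The Laplace transform maps `L²(ℝ⁺)` to the Hardy space. -/
theorem laplace_mem_hardyH2 {g : ℝ → ℂ} (hg : MemLp g 2 volPos) : laplace g ∈ hardyH2 := by
  refine ⟨differentiableOn_laplace fun z => laplaceConverges_of_memLp hg, ?_⟩
  rw [hardyNorm_eq_iSup]
  refine (iSup₂_le fun x hx => ?_).trans_lt hg.2
  simp_rw [← fourier_expWeight]
  exact (eLpNorm_fourier (integrable_expWeight hg hx) (memLp_expWeight hg hx.le)).trans_le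
    (eLpNorm_expWeight_le g hx.le)

/-! ### The Riemann-Liouville integral as a convolution -/

/-- The Riemann-Liouville kernel `t^{α-1} / Γ(α)`. -/
noncomputable def rlKernel (α t : ℝ) : ℂ := ((t ^ (α - 1) / Real.Gamma α : ℝ) : ℂ)

theorem isOpen_rightHalfPlane : IsOpen rightHalfPlane :=
  isOpen_lt continuous_const Complex.continuous_re

theorem convex_rightHalfPlane : Convex ℝ rightHalfPlane :=
  convex_halfSpace_re_gt 0

theorem ofReal_mem_rightHalfPlane {x : ℝ} (hx : 0 < x) : (x : ℂ) ∈ rightHalfPlane := by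
  simpa [rightHalfPlane] using hx

theorem laplaceConverges_rlKernel {α : ℝ} (hα : 0 < α) {z : ℂ} (hz : z ∈ rightHalfPlane) :
    LaplaceConverges (rlKernel α) z := by
  have h := integrableOn_rpow_mul_exp_neg_mul_rpow (p := 1) (s := α - 1) (b := z.re)
    (by linarith) one_pos hz
  have hm : AEStronglyMeasurable (fun t : ℝ => Complex.exp (-z * t) * rlKernel α t) volPos := by
    unfold rlKernel
    exact Measurable.aestronglyMeasurable (by fun_prop)
  refine (integrable_norm_iff hm).1 (IntegrableOn.congr_fun (h.div_const (Real.Gamma α)) (fun t ht => ?_)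
    measurableSet_Ioi)
  have ht : 0 < t := ht
  have hΓ := Real.Gamma_pos_of_pos hα
  have h1 : 0 ≤ t ^ (α - 1) / Real.Gamma α := by positivity
  rw [norm_mul, norm_exp_neg_mul, rlKernel, Complex.norm_real, Real.norm_of_nonneg h1,
    Real.rpow_one]
  ring

/-- On the positive reals this is Euler's Gamma integral. Both sides are analytic and agree at real
points accumulating at `1`, so the identity theorem extends it. -/
theorem laplace_rlKernel {α : ℝ} (hα : 0 < α) {z : ℂ} (hz : z ∈ rightHalfPlane) :
    laplace (rlKernel α) z = z ^ (-α : ℂ) := by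
  have hU := isOpen_rightHalfPlane
  have h1 : AnalyticOnNhd ℂ (laplace (rlKernel α)) rightHalfPlane :=
    (differentiableOn_laplace fun w hw => laplaceConverges_rlKernel hα hw).analyticOnNhd hU
  have h2 : AnalyticOnNhd ℂ (fun w : ℂ => w ^ (-α : ℂ)) rightHalfPlane := by
    refine DifferentiableOn.analyticOnNhd (fun w hw => ?_) hU
    exact (differentiableAt_id.cpow_const (Or.inl hw)).differentiableWithinAt
  have hreal : ∀ x : ℝ, 0 < x → laplace (rlKernel α) x = (x : ℂ) ^ (-α : ℂ) := by
    intro x hx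
    have hΓ := Real.Gamma_pos_of_pos hα
    have h := Complex.integral_cpow_mul_exp_neg_mul_Ioi (a := α) (r := x) (by simpa) hx
    have hx' : (x : ℂ).arg ≠ Real.pi := by
      rw [Complex.arg_ofReal_of_nonneg hx.le]; exact Real.pi_pos.ne
    rw [one_div, Complex.inv_cpow _ _ hx', ← Complex.cpow_neg, Complex.Gamma_ofReal] at h
    rw [← mul_div_cancel_right₀ ((x : ℂ) ^ (-α : ℂ)) (Complex.ofReal_ne_zero.2 hΓ.ne'), ← h,
      laplace, ← integral_div]
    refine setIntegral_congr_fun measurableSet_Ioi fun t ht => ?_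
    have ht : 0 < t := ht
    simp only [rlKernel]
    push_cast [Complex.ofReal_cpow ht.le]
    rw [neg_mul]
    ring
  refine h1.eqOn_of_preconnected_of_frequently_eq h2 convex_rightHalfPlane.isPreconnected
    (z₀ := ((1 : ℝ) : ℂ)) (ofReal_mem_rightHalfPlane one_pos) ?_ hz
  have ht : Filter.Tendsto (fun x : ℝ => (x : ℂ)) (𝓝[>] 1) (𝓝[≠] ((1 : ℝ) : ℂ)) := by
    refine tendsto_nhdsWithin_iff.2 ⟨?_, ?_⟩
    · exact (Complex.continuous_ofReal.tendsto 1).mono_left nhdsWithin_le_nhds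
    · filter_upwards [self_mem_nhdsWithin] with x hx
      simpa using (ne_of_gt hx : x ≠ 1)
  refine ht.frequently (Filter.Eventually.frequently ?_)
  filter_upwards [self_mem_nhdsWithin] with x hx
  exact hreal x (one_pos.trans hx)

/-- The exponential weight is multiplicative, so it distributes over the two factors of the
convolution. -/
theorem exp_mul_rlIntegral (α : ℝ) (g : ℝ → ℂ) (z : ℂ) {x : ℝ} (hx : 0 < x) :
    Complex.exp (-z * x) * rlIntegral α g x =
      ∫ t in (0)..x, ContinuousLinearMap.mul ℝ ℂ (Complex.exp (-z * t) * g t)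
        (Complex.exp (-z * (x - t : ℝ)) * rlKernel α (x - t)) := by
  rw [intervalIntegral.integral_of_le hx.le, integral_Ioc_eq_integral_Ioo, rlIntegral,
    ← integral_const_mul]
  congr 1 with t
  have : Complex.exp (-z * x) = Complex.exp (-z * t) * Complex.exp (-z * (x - t : ℝ)) := by
    rw [← Complex.exp_add]; push_cast; ring_nf
  rw [this, ContinuousLinearMap.mul_apply', rlKernel]
  ring

theorem laplaceConverges_rlIntegral {α : ℝ} (hα : 0 < α) {g : ℝ → ℂ} {z : ℂ}
    (hz : z ∈ rightHalfPlane) (hg : LaplaceConverges g z) :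
    LaplaceConverges (rlIntegral α g) z := by
  have h := integrable_posConvolution hg (laplaceConverges_rlKernel hα hz)
    (ContinuousLinearMap.mul ℝ ℂ)
  refine IntegrableOn.congr_fun ((integrable_indicator_iff measurableSet_Ioi).1 h) (fun x hx => ?_)
    measurableSet_Ioi
  exact (exp_mul_rlIntegral α g z hx).symm

/-- The Laplace transform turns the Riemann-Liouville integral into multiplication by `z^{-α}`. -/
theorem laplace_rlIntegral {α : ℝ} (hα : 0 < α) {g : ℝ → ℂ} {z : ℂ}
    (hz : z ∈ rightHalfPlane) (hg : LaplaceConverges g z) :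
    laplace (rlIntegral α g) z = z ^ (-α : ℂ) * laplace g z := by
  have h := integral_posConvolution hg (laplaceConverges_rlKernel hα hz)
    (ContinuousLinearMap.mul ℝ ℂ)
  rw [← laplace_rlKernel hα hz, mul_comm]
  refine Eq.trans (setIntegral_congr_fun measurableSet_Ioi fun x hx => ?_) h
  exact exp_mul_rlIntegral α g z hx

theorem laplace_congr {f g : ℝ → ℂ} (h : f =ᵐ[volPos] g) : laplace f = laplace g := by
  ext z
  refine integral_congr_ae ?_
  filter_upwards [h] with t ht
  rw [ht]

theorem LaplaceConverges.congr {f g : ℝ → ℂ} {z : ℂ} (hf : LaplaceConverges f z)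
    (h : f =ᵐ[volPos] g) : LaplaceConverges g z := by
  refine Integrable.congr hf ?_
  filter_upwards [h] with t ht
  rw [ht]

/-! ### Shifting vertical lines of integration -/

theorem continuous_vertical_line (x : ℝ) : Continuous fun y : ℝ => (x + y * Complex.I : ℂ) := by
  fun_prop

theorem vertical_line_mem {x : ℝ} (hx : 0 < x) (y : ℝ) :
    (x + y * Complex.I : ℂ) ∈ rightHalfPlane := by
  simpa [rightHalfPlane] using hx

/-- Cauchy's theorem on a rectangle; the bound consists of the two horizontal edges, kept as
integrals of `‖H‖ₑ` so that they can later be integrated in `R`. -/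
theorem enorm_vertical_integral_sub_le {H : ℂ → ℂ} (hH : DifferentiableOn ℂ H rightHalfPlane)
    {x₁ x₂ : ℝ} (h₁ : 0 < x₁) (h₂ : x₁ ≤ x₂) (R : ℝ) :
    ‖(∫ y in (-R)..R, H (x₂ + y * Complex.I)) - ∫ y in (-R)..R, H (x₁ + y * Complex.I)‖ₑ ≤
      (∫⁻ x in Icc x₁ x₂, ‖H (x + R * Complex.I)‖ₑ) +
        ∫⁻ x in Icc x₁ x₂, ‖H (x + (-R : ℝ) * Complex.I)‖ₑ := by
  have h := Complex.integral_boundary_rect_eq_zero_of_differentiableOn H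
    (x₁ + (-R : ℝ) * Complex.I) (x₂ + R * Complex.I) (hH.mono fun w hw => by
      have : w.re ∈ uIcc x₁ x₂ := by simpa using hw.1
      rw [uIcc_of_le h₂] at this
      exact h₁.trans_le this.1)
  simp only [Complex.add_re, Complex.add_im, Complex.ofReal_re, Complex.ofReal_im, Complex.mul_re,
    Complex.mul_im, Complex.I_re, Complex.I_im, mul_zero, mul_one, zero_add, add_zero,
    sub_self, smul_eq_mul] at h
  have hle : ∀ r : ℝ, ‖∫ x in x₁..x₂, H (x + r * Complex.I)‖ₑ ≤
      ∫⁻ x in Icc x₁ x₂, ‖H (x + r * Complex.I)‖ₑ := fun r => by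
    rw [intervalIntegral.integral_of_le h₂, ← integral_Icc_eq_integral_Ioc]
    exact enorm_integral_le_lintegral_enorm _
  refine le_trans (le_of_eq ?_) ((enorm_sub_le).trans (add_le_add (hle R) (hle (-R))))
  set A := ∫ y in (-R)..R, H (x₂ + y * Complex.I)
  set B := ∫ y in (-R)..R, H (x₁ + y * Complex.I)
  rw [show ∀ a b : ℂ, ‖a - b‖ₑ = ‖Complex.I * (a - b)‖ₑ from fun a b => by
    rw [enorm_eq_iff_norm_eq]; simp]
  congr 1
  linear_combination h

/-- A function holomorphic on the right half-plane and uniformly integrable on the vertical lines of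
a strip has the same integral over both boundary lines. -/
theorem vertical_integral_eq {H : ℂ → ℂ} (hH : DifferentiableOn ℂ H rightHalfPlane)
    {x₁ x₂ : ℝ} (h₁ : 0 < x₁) (h₂ : x₁ ≤ x₂) {C : ℝ≥0∞} (hC : C ≠ ⊤)
    (hb : ∀ x ∈ Icc x₁ x₂, ∫⁻ y : ℝ, ‖H (x + y * Complex.I)‖ₑ ≤ C) :
    ∫ y : ℝ, H (x₁ + y * Complex.I) = ∫ y : ℝ, H (x₂ + y * Complex.I) := by
  have hcont : ContinuousOn (fun p : ℝ × ℝ => H (p.1 + p.2 * Complex.I)) (Icc x₁ x₂ ×ˢ univ) :=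
    hH.continuousOn.comp (by fun_prop) fun p hp => vertical_line_mem (h₁.trans_le hp.1.1) p.2
  have hmeas : AEMeasurable (fun p : ℝ × ℝ => ‖H (p.1 + p.2 * Complex.I)‖ₑ)
      ((volume.restrict (Icc x₁ x₂)).prod volume) := by
    rw [← Measure.restrict_univ (μ := (volume : Measure ℝ)), Measure.restrict_restrict
      measurableSet_Icc, inter_univ, Measure.prod_restrict]
    exact (hcont.aestronglyMeasurable (measurableSet_Icc.prod .univ)).enorm
  set φ : ℝ → ℝ≥0∞ := fun y => ∫⁻ x in Icc x₁ x₂, ‖H (x + y * Complex.I)‖ₑ with hφ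
  -- By Tonelli, the uniform bound on vertical lines makes the horizontal edge integrals integrable
  -- in the height.
  have hφfin : ∫⁻ y, φ y ≠ ⊤ := by
    rw [hφ, ← lintegral_lintegral_swap hmeas]
    refine ne_top_of_le_ne_top ?_ (setLIntegral_mono' measurableSet_Icc hb)
    rw [setLIntegral_const]
    exact ENNReal.mul_ne_top hC (by simp)
  have hφm : AEMeasurable φ volume := hmeas.lintegral_prod_left'
  have hφ2 : ∫⁻ y, (φ y + φ (-y)) ≠ ⊤ := by
    rw [lintegral_add_left' hφm]
    have : ∫⁻ y, φ (-y) = ∫⁻ y, φ y :=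
      (Measure.measurePreserving_neg volume).lintegral_comp_emb
        (MeasurableEquiv.neg ℝ).measurableEmbedding φ
    rw [this]
    exact ENNReal.add_ne_top.2 ⟨hφfin, hφfin⟩
  have hint : ∀ x ∈ Icc x₁ x₂, Integrable fun y : ℝ => H (x + y * Complex.I) := fun x hx =>
    ⟨(hH.continuousOn.comp_continuous (continuous_vertical_line x)
      (vertical_line_mem (h₁.trans_le hx.1))).aestronglyMeasurable, (hb x hx).trans_lt hC.lt_top⟩
  have hlim : ∀ x ∈ Icc x₁ x₂, Filter.Tendsto (fun R : ℝ => ∫ y in (-R)..R, H (x + y * Complex.I))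
      Filter.atTop (𝓝 (∫ y : ℝ, H (x + y * Complex.I))) := fun x hx =>
    intervalIntegral_tendsto_integral (hint x hx) Filter.tendsto_neg_atTop_atBot Filter.tendsto_id
  have hD := ((hlim x₂ ⟨h₂, le_rfl⟩).sub (hlim x₁ ⟨le_rfl, h₂⟩)).enorm
  -- No pointwise decay of the edges is needed: if the limits differed, `φ R + φ (-R)` would stay
  -- above some `ε > 0` for all large `R`, contradicting integrability.
  by_contra hne
  have hpos : 0 < ‖(∫ y : ℝ, H (x₂ + y * Complex.I)) - ∫ y : ℝ, H (x₁ + y * Complex.I)‖ₑ := by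
    rw [enorm_pos]
    exact sub_ne_zero.2 (Ne.symm hne)
  obtain ⟨ε, hε0, hε⟩ := exists_between hpos
  obtain ⟨R₀, hR₀⟩ := Filter.eventually_atTop.1 (hD.eventually (lt_mem_nhds hε))
  refine hφ2 (top_unique ?_)
  calc ⊤ = ∫⁻ y in Ici R₀, ε := by simp [hε0.ne']
    _ ≤ ∫⁻ y in Ici R₀, (φ y + φ (-y)) := setLIntegral_mono' measurableSet_Ici fun R hR =>
        (hR₀ R hR).le.trans (enorm_vertical_integral_sub_le hH h₁ h₂ R)
    _ ≤ _ := setLIntegral_le_lintegral _ _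

/-! ### The Paley-Wiener theorem -/

/-- The restriction of `F` to the line `Re z = x`, with the frequency normalised for `𝓕`. -/
noncomputable def verticalTrace (F : ℂ → ℂ) (x ξ : ℝ) : ℂ := F (x + (2 * Real.pi * ξ : ℝ) * Complex.I)

theorem continuous_verticalTrace {F : ℂ → ℂ} (hF : DifferentiableOn ℂ F rightHalfPlane) {x : ℝ}
    (hx : 0 < x) : Continuous (verticalTrace F x) :=
  hF.continuousOn.comp_continuous (by fun_prop) fun ξ => vertical_line_mem hx _

theorem eLpNorm_verticalTrace_le (F : ℂ → ℂ) {x : ℝ} (hx : 0 < x) :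
    eLpNorm (verticalTrace F x) 2 ≤ hardyNorm F := by
  rw [hardyNorm_eq_iSup]
  exact le_iSup₂_of_le x hx le_rfl

theorem memLp_verticalTrace {F : ℂ → ℂ} (hF : F ∈ hardyH2) {x : ℝ} (hx : 0 < x) :
    MemLp (verticalTrace F x) 2 :=
  ⟨(continuous_verticalTrace hF.1 hx).aestronglyMeasurable,
    (eLpNorm_verticalTrace_le F hx).trans_lt hF.2⟩

/-- The function `t ↦ e^{xt}` cut off to `(-∞, a]`. -/
noncomputable def halfLineExp (x a : ℝ) : ℝ → ℂ := indicator (Iic a) fun t => Complex.exp (x * t)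

theorem norm_exp_ofReal_mul (x t : ℝ) : ‖Complex.exp (x * t)‖ = Real.exp (x * t) := by
  rw [Complex.norm_exp]; simp

theorem integrable_halfLineExp {x : ℝ} (hx : 0 < x) (a : ℝ) : Integrable (halfLineExp x a) := by
  refine (integrable_indicator_iff measurableSet_Iic).2 ?_
  refine (integrable_norm_iff (by fun_prop)).1 ?_
  simp_rw [norm_exp_ofReal_mul]
  exact integrableOn_exp_mul_Iic hx a

theorem memLp_halfLineExp {x : ℝ} (hx : 0 < x) (a : ℝ) : MemLp (halfLineExp x a) 2 := by
  refine (memLp_indicator_iff_restrict measurableSet_Iic).2 ?_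
  rw [memLp_two_iff_integrable_sq_norm (by fun_prop)]
  simp_rw [norm_exp_ofReal_mul, ← Real.exp_nat_mul, ← mul_assoc]
  exact integrableOn_exp_mul_Iic (by positivity) a

/-- On `t ≤ a` the ratio of the exponentials is at most `e^{(x₂ - x₁)|a|}`. This supplies the
uniformity over the strip that the contour shift requires. -/
theorem eLpNorm_halfLineExp_le {x₁ x₂ x : ℝ} (hx : x ∈ Icc x₁ x₂) (a : ℝ) :
    eLpNorm (halfLineExp x a) 2 ≤
      ENNReal.ofReal (Real.exp ((x₂ - x₁) * |a|)) * eLpNorm (halfLineExp x₁ a) 2 := by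
  refine eLpNorm_le_mul_eLpNorm_of_ae_le_mul (.of_forall fun t => ?_) 2
  by_cases ht : t ∈ Iic a
  · simp only [halfLineExp, indicator_of_mem ht, norm_exp_ofReal_mul]
    rw [← Real.exp_add]
    refine Real.exp_le_exp.2 ?_
    have h1 : t ≤ |a| := le_trans ht (le_abs_self a)
    have h2 : (x - x₁) * t ≤ (x - x₁) * |a| := by
      have := hx.1
      gcongr
    have h3 : (x - x₁) * |a| ≤ (x₂ - x₁) * |a| := by
      have := hx.2
      gcongr
    linarith
  · simp [halfLineExp, indicator_of_notMem ht]

theorem fourier_halfLineExp {x : ℝ} (hx : 0 < x) (a ξ : ℝ) :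
    𝓕 (halfLineExp x a) ξ = Complex.exp ((x - (2 * Real.pi * ξ : ℝ) * Complex.I) * a) /
      (x - (2 * Real.pi * ξ : ℝ) * Complex.I) := by
  rw [Real.fourier_real_eq_integral_exp_smul,
    ← integral_exp_mul_complex_Iic (by simpa using hx), ← integral_indicator measurableSet_Iic]
  congr 1 with t
  by_cases ht : t ∈ Iic a
  · simp only [halfLineExp, indicator_of_mem ht, smul_eq_mul, ← Complex.exp_add]
    congr 1
    push_cast
    ring
  · simp [halfLineExp, indicator_of_notMem ht]

/-- The kernel `e^{za}/z`, which is conjugate to the Fourier transform of `halfLineExp`. -/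
noncomputable def halfLineKernel (a : ℝ) (z : ℂ) : ℂ := Complex.exp (z * a) / z

theorem conj_fourier_halfLineExp {x : ℝ} (hx : 0 < x) (a ξ : ℝ) :
    (starRingEnd ℂ) (𝓕 (halfLineExp x a) ξ) = verticalTrace (halfLineKernel a) x ξ := by
  rw [fourier_halfLineExp hx]
  simp [verticalTrace, halfLineKernel, ← Complex.exp_conj, Complex.conj_ofNat]

theorem eLpNorm_verticalTrace_halfLineKernel {x : ℝ} (hx : 0 < x) (a : ℝ) :
    eLpNorm (verticalTrace (halfLineKernel a) x) 2 = eLpNorm (halfLineExp x a) 2 := by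
  rw [← eLpNorm_fourier (integrable_halfLineExp hx a) (memLp_halfLineExp hx a)]
  refine eLpNorm_congr_norm_ae (.of_forall fun ξ => ?_)
  rw [← conj_fourier_halfLineExp hx, RCLike.norm_conj]

theorem differentiableOn_halfLineKernel (a : ℝ) :
    DifferentiableOn ℂ (halfLineKernel a) rightHalfPlane := by
  refine DifferentiableOn.div (by fun_prop) differentiableOn_id fun z hz h => ?_
  have : (0 : ℝ) < z.re := hz
  simp_all

/-- Parseval's identity against `halfLineExp`. -/
theorem integral_Iic_exp_mul_fourierInv {x : ℝ} (hx : 0 < x) (a : ℝ)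
    (u : Lp ℂ 2 (volume : Measure ℝ)) :
    ∫ t in Iic a, Complex.exp (x * t) * (𝓕⁻ u : Lp ℂ 2 (volume : Measure ℝ)) t =
      ∫ ξ, verticalTrace (halfLineKernel a) x ξ * u ξ := by
  have hk := memLp_halfLineExp hx a
  have h := Lp.inner_fourier_eq (hk.toLp _) (𝓕⁻ u)
  rw [FourierTransform.fourier_fourierInv_eq, L2.inner_def, L2.inner_def] at h
  rw [← integral_indicator measurableSet_Iic]
  refine Eq.trans ?_ (h.symm.trans ?_)
  · refine integral_congr_ae ?_
    filter_upwards [hk.coeFn_toLp] with t ht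
    rw [ht, RCLike.inner_apply, mul_comm]
    by_cases hta : t ∈ Iic a
    · simp [halfLineExp, indicator_of_mem hta, ← Complex.exp_conj]
    · simp [halfLineExp, indicator_of_notMem hta]
  · refine integral_congr_ae ?_
    filter_upwards [coeFn_fourier_toLp (integrable_halfLineExp hx a) hk] with ξ hξ
    rw [hξ, RCLike.inner_apply, conj_fourier_halfLineExp hx, mul_comm]

/-- Both traces are in `L²` with norms bounded over the strip, so by Cauchy-Schwarz the product is
uniformly integrable on its lines and `vertical_integral_eq` applies. -/
theorem integral_halfLineKernel_eq {F : ℂ → ℂ} (hF : F ∈ hardyH2) (a : ℝ) {x₁ x₂ : ℝ}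
    (h₁ : 0 < x₁) (h₂ : x₁ ≤ x₂) :
    ∫ ξ, verticalTrace (halfLineKernel a) x₁ ξ * verticalTrace F x₁ ξ =
      ∫ ξ, verticalTrace (halfLineKernel a) x₂ ξ * verticalTrace F x₂ ξ := by
  set H : ℂ → ℂ := fun z => halfLineKernel a z * F z with hH
  have hscale : ∀ x : ℝ, ∫ ξ, verticalTrace (halfLineKernel a) x ξ * verticalTrace F x ξ =
      |(2 * Real.pi)⁻¹| • ∫ y : ℝ, H (x + y * Complex.I) := fun x =>
    Measure.integral_comp_mul_left (fun y : ℝ => H (x + y * Complex.I)) (2 * Real.pi)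
  rw [hscale, hscale]
  congr 1
  set B := ENNReal.ofReal (Real.exp ((x₂ - x₁) * |a|)) * eLpNorm (halfLineExp x₁ a) 2
  have hB : B ≠ ⊤ := ENNReal.mul_ne_top ENNReal.ofReal_ne_top (memLp_halfLineExp h₁ a).2.ne
  refine vertical_integral_eq (C := ENNReal.ofReal (2 * Real.pi) * (B * hardyNorm F))
    ((differentiableOn_halfLineKernel a).mul hF.1) h₁ h₂
    (ENNReal.mul_ne_top ENNReal.ofReal_ne_top (ENNReal.mul_ne_top hB hF.2.ne)) fun x hx => ?_
  have hx0 : 0 < x := h₁.trans_le hx.1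
  have hs := lintegral_comp_two_pi_mul fun y => ‖H (x + y * Complex.I)‖ₑ
  have hs' : ∫⁻ y : ℝ, ‖H (x + y * Complex.I)‖ₑ = ENNReal.ofReal (2 * Real.pi) *
      ∫⁻ ξ : ℝ, ‖H (x + (2 * Real.pi * ξ : ℝ) * Complex.I)‖ₑ := by
    rw [hs, ← mul_assoc, ← ENNReal.ofReal_mul (by positivity),
      mul_one_div_cancel (by positivity), ENNReal.ofReal_one, one_mul]
  refine hs'.trans_le ?_
  gcongr
  have hm := (continuous_verticalTrace hF.1 hx0).aestronglyMeasurable (μ := volume)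
  have hk := (continuous_verticalTrace (differentiableOn_halfLineKernel a)
    hx0).aestronglyMeasurable (μ := volume)
  have hold := eLpNorm_smul_le_mul_eLpNorm (p := 2) (q := 2) (r := 1) hm hk
  rw [eLpNorm_one_eq_lintegral_enorm] at hold
  refine hold.trans ?_
  rw [eLpNorm_verticalTrace_halfLineKernel hx0]
  gcongr
  · exact eLpNorm_halfLineExp_le hx a
  · exact eLpNorm_verticalTrace_le F hx0

/-- Functions with the same integrals over all half-lines `(-∞, a]` agree almost everywhere. -/
theorem ae_eq_of_integral_Iic_eq {f g : ℝ → ℂ} (hf : ∀ a, IntegrableOn f (Iic a))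
    (hg : ∀ a, IntegrableOn g (Iic a)) (h : ∀ a, ∫ t in Iic a, f t = ∫ t in Iic a, g t) :
    f =ᵐ[volume] g := by
  have hd : ∀ a, IntegrableOn (f - g) (Iic a) := fun a => (hf a).sub (hg a)
  have hloc : LocallyIntegrable (f - g) := fun x =>
    ⟨Iic (x + 1), Iic_mem_nhds (by linarith), hd _⟩
  have h0 : ∀ x, ∫ t in (0)..x, (f - g) t = 0 := fun x => by
    rw [← intervalIntegral.integral_Iic_sub_Iic (hd 0) (hd x)]
    have : ∀ a, ∫ t in Iic a, (f - g) t = 0 := fun a => by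
      rw [integral_sub' (hf a) (hg a), h a, sub_self]
    rw [this, this, sub_self]
  -- Lebesgue differentiation: the primitive of `f - g` vanishes identically.
  filter_upwards [LocallyIntegrable.ae_hasDerivAt_integral hloc] with x hx
  have h1 := hx 0
  simp_rw [h0] at h1
  exact sub_eq_zero.1 (h1.unique (hasDerivAt_const x 0))

/-- A function whose exponential weights `e^{-xt}`, `x > 0`, are bounded in `L²` is supported on
`[0, ∞)` and belongs to `L²`. -/
theorem support_and_bound_of_weighted {G : ℝ → ℂ} (hG : StronglyMeasurable G) {C : ℝ≥0∞}
    (hC : C < ⊤) (hb : ∀ x : ℝ, 0 < x → eLpNorm (fun t : ℝ => Complex.exp (-x * t) * G t) 2 ≤ C) :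
    (∀ᵐ t, t < 0 → G t = 0) ∧ MemLp G 2 := by
  have hm : ∀ x : ℝ, StronglyMeasurable (fun t : ℝ => Complex.exp (-x * t) * G t) := fun x =>
    StronglyMeasurable.mul (Continuous.stronglyMeasurable (by fun_prop)) hG
  -- Fatou's lemma along an arbitrary sequence of weights.
  have key : ∀ v : ℕ → ℝ, (∀ n, 0 < v n) → ∫⁻ t : ℝ, Filter.liminf
      (fun n => ‖Complex.exp (-v n * t) * G t‖ₑ ^ 2) Filter.atTop ≤ C ^ 2 := fun v hv => by
    refine (lintegral_liminf_le fun n => (hm (v n)).enorm.pow_const 2).trans ?_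
    refine (Filter.liminf_le_liminf (.of_forall fun n => ?_)).trans
      (Filter.liminf_const (f := Filter.atTop (α := ℕ)) (C ^ 2)).le
    rw [lintegral_enorm_sq_eq]
    gcongr
    exact hb _ (hv n)
  have hC2 : C ^ 2 < ⊤ := ENNReal.pow_lt_top hC
  constructor
  -- Weights tending to infinity: where `t < 0` and `G t ≠ 0` the liminf is infinite, but it is
  -- finite almost everywhere.
  · have h := key (fun n => n + 1) fun n => by positivity
    have h' := ae_lt_top (Measurable.liminf fun n => (hm _).enorm.pow_const 2)
      (h.trans_lt hC2).ne
    filter_upwards [h'] with t ht ht0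
    by_contra hGt
    refine ht.ne (Filter.Tendsto.liminf_eq ?_)
    have h1 : ∀ n : ℕ, ‖Complex.exp (-((n + 1 : ℝ) : ℂ) * t) * G t‖ₑ ^ 2 =
        ENNReal.ofReal ((Real.exp ((n + 1 : ℝ) * (-t)) * ‖G t‖) ^ 2) := fun n => by
      rw [ENNReal.ofReal_pow (by positivity), ← ofReal_norm, norm_mul, norm_exp_neg_mul,
        Complex.ofReal_re, neg_mul_comm]
    simp_rw [h1]
    refine ENNReal.tendsto_ofReal_atTop.comp ?_
    refine (Filter.tendsto_pow_atTop two_ne_zero).comp ?_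
    refine Filter.Tendsto.atTop_mul_const (norm_pos_iff.2 hGt) ?_
    refine Real.tendsto_exp_atTop.comp (Filter.Tendsto.atTop_mul_const (by linarith) ?_)
    exact Filter.tendsto_atTop_add_const_right _ _ tendsto_natCast_atTop_atTop
  -- Weights tending to zero: the liminf is `‖G t‖ₑ ^ 2` itself.
  · have h := key (fun n => 1 / ((n : ℝ) + 1)) fun n => by positivity
    have h1 : ∀ t : ℝ, Filter.liminf (fun n : ℕ =>
        ‖Complex.exp (-((1 / ((n : ℝ) + 1) : ℝ) : ℂ) * t) * G t‖ₑ ^ 2) Filter.atTop =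
        ‖G t‖ₑ ^ 2 := fun t => by
      refine Filter.Tendsto.liminf_eq ?_
      have hc : Continuous fun s : ℝ => ‖Complex.exp (-(s : ℂ) * t) * G t‖ₑ ^ 2 := by fun_prop
      simpa [Function.comp_def] using (hc.tendsto 0).comp tendsto_one_div_add_atTop_nhds_zero_nat
    simp_rw [h1, lintegral_enorm_sq_eq] at h
    exact ⟨hG.aestronglyMeasurable, ENNReal.pow_lt_top_iff.1 (h.trans_lt hC2) |>.resolve_right (by norm_num)⟩

/-- The Paley-Wiener theorem: every Hardy function is the Laplace transform of an `L²` function. -/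
theorem exists_laplace_eq_of_mem_hardyH2 {F : ℂ → ℂ} (hF : F ∈ hardyH2) :
    ∃ g : L2Pos, ∀ z ∈ rightHalfPlane, laplace g z = F z := by
  have hu : ∀ x : ℝ, 0 < x → MemLp (verticalTrace F x) 2 := fun x hx => memLp_verticalTrace hF hx
  choose! U hU using fun (x : ℝ) (hx : 0 < x) =>
    (⟨(hu x hx).toLp _, (hu x hx).coeFn_toLp⟩ :
      ∃ U : Lp ℂ 2 (volume : Measure ℝ), U =ᵐ[volume] verticalTrace F x)
  set γ : ℝ → Lp ℂ 2 (volume : Measure ℝ) := fun x => 𝓕⁻ (U x) with hγ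
  have hint : ∀ x : ℝ, 0 < x → ∀ a : ℝ,
      IntegrableOn (fun t : ℝ => Complex.exp (x * t) * γ x t) (Iic a) := fun x hx a => by
    have h := (memLp_halfLineExp hx a).integrable_mul (Lp.memLp (γ x))
    refine IntegrableOn.congr_fun (h.integrableOn (s := Iic a)) (fun t ht => ?_) measurableSet_Iic
    simp [halfLineExp, indicator_of_mem ht]
  have hval : ∀ x : ℝ, 0 < x → ∀ a : ℝ, ∫ t in Iic a, Complex.exp (x * t) * γ x t =
      ∫ ξ, verticalTrace (halfLineKernel a) x ξ * verticalTrace F x ξ := fun x hx a => by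
    rw [hγ, integral_Iic_exp_mul_fourierInv hx]
    refine integral_congr_ae ?_
    filter_upwards [hU x hx] with ξ hξ
    rw [hξ]
  -- The choice `x = 1` is arbitrary; `hGx` shows that every line gives the same function.
  set G : ℝ → ℂ := fun t => Complex.exp ((1 : ℝ) * t) * γ 1 t with hGdef
  have hGm : StronglyMeasurable G :=
    StronglyMeasurable.mul (Continuous.stronglyMeasurable (by fun_prop)) (Lp.stronglyMeasurable _)
  have hGx : ∀ x : ℝ, 0 < x → (fun t : ℝ => Complex.exp (-x * t) * G t) =ᵐ[volume] γ x := by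
    intro x hx
    have : (fun t : ℝ => Complex.exp (x * t) * γ x t) =ᵐ[volume] G := by
      refine ae_eq_of_integral_Iic_eq (hint x hx) (hint 1 one_pos) fun a => ?_
      rw [hval x hx, hval 1 one_pos]
      rcases le_total x 1 with h | h
      · exact integral_halfLineKernel_eq hF a hx h
      · exact (integral_halfLineKernel_eq hF a one_pos h).symm
    filter_upwards [this] with t ht
    rw [← ht, ← mul_assoc, ← Complex.exp_add]
    simp
  obtain ⟨hsupp, hG2⟩ := support_and_bound_of_weighted hGm hF.2 fun x hx => by
    rw [eLpNorm_congr_ae (hGx x hx), ← Lp.enorm_def, ← ofReal_norm,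
      ← Lp.norm_fourier_eq, hγ, FourierTransform.fourier_fourierInv_eq, ofReal_norm, Lp.enorm_def,
      eLpNorm_congr_ae (hU x hx)]
    exact eLpNorm_verticalTrace_le F hx
  have hGp : MemLp G 2 volPos := hG2.restrict _
  refine ⟨hGp.toLp G, fun z hz => ?_⟩
  rw [laplace_congr hGp.coeFn_toLp]
  have hz : 0 < z.re := hz
  have hw : expWeight z.re G =ᵐ[volume] γ z.re := by
    filter_upwards [hsupp, hGx _ hz, Measure.ae_ne volume 0] with t ht htx ht0
    rcases lt_or_gt_of_ne ht0 with h | h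
    · rw [← htx, ht h, expWeight, indicator_of_notMem (by simpa using h.le)]
      simp
    · rw [← htx, expWeight, indicator_of_mem (by simpa using h)]
  have hL : (memLp_expWeight hGp hz.le).toLp _ = γ z.re :=
    Lp.ext ((memLp_expWeight hGp hz.le).coeFn_toLp.trans hw)
  have hE := coeFn_fourier_toLp (integrable_expWeight hGp hz) (memLp_expWeight hGp hz.le)
  rw [hL, hγ, FourierTransform.fourier_fourierInv_eq] at hE
  -- Continuity of both sides upgrades a.e. equality on the line to equality at every point, in
  -- particular at `z`.
  have hfun : 𝓕 (expWeight z.re G) = verticalTrace F z.re :=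
    ((continuous_fourier_of_integrable (integrable_expWeight hGp hz)).ae_eq_iff_eq volume
      (continuous_verticalTrace hF.1 hz)).1 (hE.symm.trans (hU _ hz))
  have := congr_fun hfun (z.im / (2 * Real.pi))
  rw [fourier_expWeight, verticalTrace, mul_div_cancel₀ _ (by positivity), Complex.re_add_im]
    at this
  exact this

/-! ### Injectivity of `𝒟^{-α}` and conclusion -/

/-- The Riemann-Liouville integral is injective on `L²(ℝ⁺)`. -/
theorem eq_of_rlIntegral_ae_eq {α : ℝ} (hα : 0 < α) {g h : L2Pos}
    (H : rlIntegral α g =ᵐ[volPos] rlIntegral α h) : g = h := by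
  refine Lp.ext (ae_eq_of_laplace_eq (Lp.memLp g) (Lp.memLp h) fun z hz => ?_)
  have hz0 : z ≠ 0 := by
    rintro rfl
    simp [rightHalfPlane] at hz
  have := congr_fun (laplace_congr H) z
  rw [laplace_rlIntegral hα hz (laplaceConverges_of_memLp (Lp.memLp g) hz),
    laplace_rlIntegral hα hz (laplaceConverges_of_memLp (Lp.memLp h) hz)] at this
  exact mul_left_cancel₀ (by simp [Complex.cpow_eq_zero_iff, hz0]) this

theorem ae_eq_rlIntegral_rlDeriv {α : ℝ} {φ : ℝ → ℂ} (hφ : φ ∈ rlSpace α) :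
    φ =ᵐ[volPos] rlIntegral α (rlDeriv α φ) := by
  have h : ∃ g : L2Pos, φ =ᵐ[volPos] rlIntegral α g := hφ
  rw [rlDeriv, dif_pos h]
  exact h.choose_spec

theorem corollary5p4 (α : ℝ) (hα : 0 < α) :
    (∀ φ ∈ rlSpace α,
      (∃! g : L2Pos, φ =ᵐ[volPos] rlIntegral α g) ∧
      ∀ z ∈ rightHalfPlane,
        LaplaceConverges φ z ∧ LaplaceConverges (rlDeriv α φ) z ∧
        laplace (rlDeriv α φ) z = z ^ (α : ℂ) * laplace φ z) ∧
    (fun φ : ℝ → ℂ => rightHalfPlane.domRestrict (laplace φ)) '' rlSpace α =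
      (fun F : ℂ → ℂ => rightHalfPlane.domRestrict (fun z => z ^ (-α : ℂ) * F z)) '' hardyH2 := by
  refine ⟨fun φ hφ => ⟨?_, fun z hz => ?_⟩, ?_⟩
  · obtain ⟨g, hg⟩ := hφ
    exact ⟨g, hg, fun h hh => eq_of_rlIntegral_ae_eq hα (hh.symm.trans hg)⟩
  · have hD := ae_eq_rlIntegral_rlDeriv hφ
    have hc := laplaceConverges_of_memLp (Lp.memLp (rlDeriv α φ)) hz
    refine ⟨(laplaceConverges_rlIntegral hα hz hc).congr hD.symm, hc, ?_⟩
    have hz0 : z ≠ 0 := by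
      rintro rfl
      simp [rightHalfPlane] at hz
    rw [laplace_congr hD, laplace_rlIntegral hα hz hc, ← mul_assoc, ← Complex.cpow_add _ _ hz0]
    simp
  · ext Φ
    constructor
    · rintro ⟨φ, ⟨g, hg⟩, rfl⟩
      refine ⟨laplace g, laplace_mem_hardyH2 (Lp.memLp g), ?_⟩
      ext ⟨z, hz⟩
      have hc := laplaceConverges_of_memLp (Lp.memLp g) hz
      simpa [laplace_congr hg] using (laplace_rlIntegral hα hz hc).symm
    · rintro ⟨F, hF, rfl⟩
      obtain ⟨g, hg⟩ := exists_laplace_eq_of_mem_hardyH2 hF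
      refine ⟨rlIntegral α g, ⟨g, .rfl⟩, ?_⟩
      ext ⟨z, hz⟩
      have hc := laplaceConverges_of_memLp (Lp.memLp g) hz
      simpa [hg z hz] using laplace_rlIntegral hα hz hc
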